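/- A partition of $[0,1)$ is a finite or countable family of pairwise disjoint Lebesgue measurable sets with union $[0,1)$. Let $\{\mathcal A_n\}_{n\ge 1}$ be a filtration, i.e. a sequence of partitions of $[0,1)$ such that every $A\in\mathcal A_n$ is a union of sets from $\mathcal A_{n+1}$. Let $f_n\in L^1(0,1)$, $n\ge 1$, be a (real) martingale difference based on it: every $f_n$ is constant on each $A\in\mathcal A_n$, and $\int_A f_n=0$ for every $A\in\mathcal A_{n-1}$, $n\ge 2$. Let $G_n\subset\mathbb N$, $n\ge 1$, be finite and pairwise disjoint, let $c_j\in\mathbb R$, and suppose that the polynomials $$p_n(x)=\sum_{j\in G_n}c_jf_j(x),\qquad n=1,2,\ldots,$$ satisfy $\|p_n\|_{L^2(0,1)}=1$. Then $\log_2 n$ is an a.e. convergence Weyl multiplier for $\{p_n\}$. That is, $\{p_n\}$ is an orthonormal system in $L^2(0,1)$, the nonnegative sequence $\log_2 n$ increases to infinity, and for all real coefficients $a_n$ with $\sum_{n=1}^\infty a_n^2\log_2 n<\infty$ the series $\sum_{n=1}^\infty a_np_n(x)$ converges for almost every $x\in[0,1)$. -/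

import Mathlib

open MeasureTheory Set Filter Topology

/-- Lebesgue measure on the unit interval `[0,1)`. -/
noncomputable def unitMeasure : Measure ℝ := volume.restrict (Ico (0 : ℝ) 1)

/-- A partition of `[0,1)`: a finite or countable family of pairwise disjoint
Lebesgue measurable sets whose union is `[0,1)`. -/
structure IsUnitPartition (P : Set (Set ℝ)) : Prop where
  countable : P.Countable
  measurable : ∀ A ∈ P, NullMeasurableSet A volume
  disjoint : P.PairwiseDisjoint id
  sUnion_eq : ⋃₀ P = Ico (0 : ℝ) 1

/-- A filtration: a sequence of partitions of `[0,1)` such that every cell of a partition is a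
union of cells of the next one. (Sequences `n = 1, 2, …` are indexed from `0` throughout.) -/
structure IsPartitionFiltration (𝒜 : ℕ → Set (Set ℝ)) : Prop where
  partition : ∀ n, IsUnitPartition (𝒜 n)
  refine_next : ∀ n, ∀ A ∈ 𝒜 n, ∃ C ⊆ 𝒜 (n + 1), A = ⋃₀ C

/-- `f` is a martingale difference based on the filtration `𝒜`. As members of `L¹(0,1)`,
the functions are only required to be constant almost everywhere on the cells. -/
structure IsMartingaleDifferenceOn (𝒜 : ℕ → Set (Set ℝ)) (f : ℕ → ℝ → ℝ) : Prop where
  integrable : ∀ n, Integrable (f n) unitMeasure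
  const_on : ∀ n, ∀ A ∈ 𝒜 n, ∃ v : ℝ, ∀ᵐ x ∂(volume.restrict A), f n x = v
  integral_eq_zero : ∀ n, ∀ A ∈ 𝒜 n, ∫ x in A, f (n + 1) x = 0

/-- `f` is a martingale difference, based on some filtration of partitions of `[0,1)`. -/
def IsMartingaleDifference (f : ℕ → ℝ → ℝ) : Prop :=
  ∃ 𝒜 : ℕ → Set (Set ℝ), IsPartitionFiltration 𝒜 ∧ IsMartingaleDifferenceOn 𝒜 f

/-- `φ` is an orthonormal system in `L²(0,1)`. -/
structure IsOrthonormalSystem (φ : ℕ → ℝ → ℝ) : Prop where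
  memLp : ∀ n, MemLp (φ n) 2 unitMeasure
  integral_mul : ∀ m n, ∫ x, φ m x * φ n x ∂unitMeasure = if m = n then 1 else 0

/-- `ω` is an a.e. convergence Weyl multiplier (C-multiplier) for the orthonormal system `φ`:
`ω` increases to infinity, and `∑ aₙ φₙ` converges a.e. whenever `∑ aₙ² ω(n) < ∞`.
`ω` is only asked to be nonnegative (hence eventually positive), so that `log n`, which
vanishes at `n = 1`, qualifies. -/
structure IsCMultiplier (ω : ℕ → ℝ) (φ : ℕ → ℝ → ℝ) : Prop where
  orthonormal : IsOrthonormalSystem φ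
  nonneg : ∀ n, 0 ≤ ω n
  mono : Monotone ω
  tendsto : Tendsto ω atTop atTop
  converges : ∀ a : ℕ → ℝ, Summable (fun n => a n ^ 2 * ω n) →
    ∀ᵐ x ∂unitMeasure, ∃ s : ℝ,
      Tendsto (fun N => ∑ n ∈ Finset.range N, a n * φ n x) atTop (𝓝 s)

/-! The blocks `G n` may interleave, so the partial sums of `∑ a n * p n` need not form a martingale
and Doob's maximal inequality is not available. The substitute is a tail bound valid for the sum
over any finite index set, followed by a union bound.

From `exp (x - x ^ 2) ≤ 1 + x + x ^ 2`, one step gives conditional mean at most `(1 + v) * exp (-v)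
≤ 1` for `exp (Y - Y ^ 2 - v)`, where `v` is the conditional mean of `Y ^ 2`. Hence `∑ X j` minus
its square function and its conditional square function has a bounded exponential moment, with no
bound on the jumps (`lintegral_exp_le`). Both square functions increase with the index set. Off the
single set where those of `J` are large, every `H ⊆ J` therefore has a subgaussian tail
(`measure_sum_ge_le`, `measure_max_ge_le`), and Chebyshev controls that set.

Take blocks of `n` between `2 ^ 2 ^ k - 1` and `2 ^ 2 ^ (k + 1) - 1` with `L = 2 ^ k`. The tail
beats the number of partial sums, and the Chebyshev terms `2 ^ k * E k`, with `E k` the energy of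
the block, are summable by the logarithmic weight. Borel–Cantelli kills the oscillation inside
blocks; the block sums themselves converge absolutely (`ae_tendsto_sum`). -/

instance isProbabilityMeasure_unitMeasure : IsProbabilityMeasure unitMeasure :=
  ⟨by simp [unitMeasure]⟩

/-! ### Integration cell by cell. -/

namespace IsUnitPartition

variable {P : Set (Set ℝ)}

theorem subset_Ico (hP : IsUnitPartition P) {A : Set ℝ} (hA : A ∈ P) : A ⊆ Ico (0 : ℝ) 1 :=
  hP.sUnion_eq ▸ subset_sUnion_of_mem hA

theorem restrict_eq (hP : IsUnitPartition P) {A : Set ℝ} (hA : A ∈ P) :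
    unitMeasure.restrict A = volume.restrict A :=
  Measure.restrict_restrict_of_subset (hP.subset_Ico hA)

theorem isFiniteMeasure_restrict (hP : IsUnitPartition P) {A : Set ℝ} (hA : A ∈ P) :
    IsFiniteMeasure (volume.restrict A) := by
  rw [← hP.restrict_eq hA]; infer_instance

theorem volume_ne_top (hP : IsUnitPartition P) {A : Set ℝ} (hA : A ∈ P) : volume A ≠ ⊤ :=
  ((measure_mono (hP.subset_Ico hA)).trans_lt (by simp)).ne

theorem unitMeasure_eq (hP : IsUnitPartition P) :
    unitMeasure = volume.restrict (⋃ A : P, (A : Set ℝ)) := by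
  rw [← sUnion_eq_iUnion, hP.sUnion_eq]; rfl

theorem pairwise_aedisjoint (hP : IsUnitPartition P) :
    Pairwise fun A B : P => AEDisjoint volume (A : Set ℝ) B := fun A B hAB =>
  (hP.disjoint A.2 B.2 (fun h => hAB (Subtype.ext h))).aedisjoint

theorem lintegral_eq_tsum (hP : IsUnitPartition P) (g : ℝ → ENNReal) :
    ∫⁻ x, g x ∂unitMeasure = ∑' A : P, ∫⁻ x in (A : Set ℝ), g x := by
  have := hP.countable.to_subtype
  rw [hP.unitMeasure_eq, lintegral_iUnion₀ (fun A : P => hP.measurable A A.2)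
    hP.pairwise_aedisjoint]

theorem lintegral_mono_cells (hP : IsUnitPartition P) {g h : ℝ → ENNReal}
    (H : ∀ A ∈ P, ∫⁻ x in A, g x ≤ ∫⁻ x in A, h x) :
    ∫⁻ x, g x ∂unitMeasure ≤ ∫⁻ x, h x ∂unitMeasure := by
  rw [hP.lintegral_eq_tsum, hP.lintegral_eq_tsum]
  exact ENNReal.tsum_le_tsum fun A => H A A.2

theorem integral_sUnion_eq_zero (hP : IsUnitPartition P) {C : Set (Set ℝ)} (hC : C ⊆ P)
    {g : ℝ → ℝ} (hg : Integrable g unitMeasure) (H : ∀ B ∈ C, ∫ x in B, g x = 0) :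
    ∫ x in ⋃₀ C, g x = 0 := by
  have := (hP.countable.mono hC).to_subtype
  have hg' : IntegrableOn g (⋃ B : C, (B : Set ℝ)) volume := by
    refine IntegrableOn.mono_set (t := Ico (0 : ℝ) 1) hg ?_
    exact iUnion_subset fun B => hP.subset_Ico (hC B.2)
  rw [sUnion_eq_iUnion, integral_iUnion_ae (fun B : C => hP.measurable B (hC B.2)) _ hg']
  · simp [H]
  · exact fun A B hAB =>
      (hP.disjoint (hC A.2) (hC B.2) (fun h => hAB (Subtype.ext h))).aedisjoint

theorem integral_eq_zero (hP : IsUnitPartition P) {g : ℝ → ℝ} (hg : Integrable g unitMeasure)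
    (H : ∀ B ∈ P, ∫ x in B, g x = 0) : ∫ x, g x ∂unitMeasure = 0 := by
  have := hP.integral_sUnion_eq_zero subset_rfl hg H
  rwa [hP.sUnion_eq] at this

theorem integrable_restrict (hP : IsUnitPartition P) {A : Set ℝ} (hA : A ∈ P) {g : ℝ → ℝ}
    (hg : Integrable g unitMeasure) : Integrable g (volume.restrict A) := by
  rw [← hP.restrict_eq hA]; exact hg.restrict

end IsUnitPartition

/-! ### Cellwise constant functions and cell means. -/

/-- `g` is constant almost everywhere on the cells of `P`. -/
def CellConst (P : Set (Set ℝ)) (g : ℝ → ℝ) : Prop :=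
  ∀ A ∈ P, ∃ v : ℝ, ∀ᵐ x ∂(volume.restrict A), g x = v

namespace CellConst

variable {P : Set (Set ℝ)} {g h : ℝ → ℝ}

theorem const (v : ℝ) : CellConst P fun _ => v := fun _ _ => ⟨v, by simp⟩

theorem comp (hg : CellConst P g) (φ : ℝ → ℝ) : CellConst P fun x => φ (g x) := fun A hA => by
  obtain ⟨v, hv⟩ := hg A hA
  exact ⟨φ v, hv.mono fun x hx => by simp [hx]⟩

theorem comp₂ (hg : CellConst P g) (hh : CellConst P h) (φ : ℝ → ℝ → ℝ) :
    CellConst P fun x => φ (g x) (h x) := fun A hA => by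
  obtain ⟨v, hv⟩ := hg A hA
  obtain ⟨w, hw⟩ := hh A hA
  exact ⟨φ v w, by filter_upwards [hv, hw] with x h1 h2; rw [h1, h2]⟩

theorem sum {ι : Type*} (s : Finset ι) {F : ι → ℝ → ℝ} (hF : ∀ i ∈ s, CellConst P (F i)) :
    CellConst P fun x => ∑ i ∈ s, F i x := by
  classical
  induction s using Finset.induction_on with
  | empty => simpa using const 0
  | insert i s hi ih =>
    simp only [Finset.sum_insert hi]
    exact (hF i (by simp)).comp₂ (ih fun j hj => hF j (by simp [hj])) (· + ·)

theorem aemeasurable (hP : IsUnitPartition P) (hg : CellConst P g) :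
    AEMeasurable g unitMeasure := by
  have := hP.countable.to_subtype
  rw [hP.unitMeasure_eq, aemeasurable_iUnion_iff]
  intro A
  obtain ⟨v, hv⟩ := hg A A.2
  exact ⟨fun _ => v, measurable_const, hv⟩

end CellConst

/-- The mean of `g` over the cell of `P` containing `x`. -/
noncomputable def cellMean (P : Set (Set ℝ)) (g : ℝ → ℝ) (x : ℝ) : ℝ :=
  (∫ y in ⋃₀ {A ∈ P | x ∈ A}, g y) / volume.real (⋃₀ {A ∈ P | x ∈ A})

theorem IsUnitPartition.cellMean_eq {P : Set (Set ℝ)} (hP : IsUnitPartition P) (g : ℝ → ℝ)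
    {A : Set ℝ} (hA : A ∈ P) {x : ℝ} (hx : x ∈ A) :
    cellMean P g x = (∫ y in A, g y) / volume.real A := by
  have : {B ∈ P | x ∈ B} = {A} := by
    ext B
    refine ⟨fun hB => ?_, fun hB => by rw [hB]; exact ⟨hA, hx⟩⟩
    exact hP.disjoint.elim_set hB.1 hA x hB.2 hx
  simp [cellMean, this]

theorem IsUnitPartition.cellMean_ae {P : Set (Set ℝ)} (hP : IsUnitPartition P) (g : ℝ → ℝ)
    {A : Set ℝ} (hA : A ∈ P) :
    ∀ᵐ x ∂(volume.restrict A), cellMean P g x = (∫ y in A, g y) / volume.real A :=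
  (ae_restrict_mem₀ (hP.measurable A hA)).mono fun _ hx => hP.cellMean_eq g hA hx

theorem IsUnitPartition.cellConst_cellMean {P : Set (Set ℝ)} (hP : IsUnitPartition P)
    (g : ℝ → ℝ) : CellConst P (cellMean P g) := fun _ hA => ⟨_, hP.cellMean_ae g hA⟩

theorem cellMean_const_mul (P : Set (Set ℝ)) (t : ℝ) (g : ℝ → ℝ) (x : ℝ) :
    cellMean P (fun y => t * g y) x = t * cellMean P g x := by
  simp [cellMean, integral_const_mul, mul_div_assoc]

theorem cellMean_nonneg (P : Set (Set ℝ)) {g : ℝ → ℝ} (hg : ∀ x, 0 ≤ g x) (x : ℝ) :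
    0 ≤ cellMean P g x :=
  div_nonneg (integral_nonneg hg) measureReal_nonneg

/-- Null cells need no exclusion: there the quotient is `0` by convention and the integral vanishes
too. -/
theorem IsUnitPartition.integral_div_mul_volume {P : Set (Set ℝ)} (hP : IsUnitPartition P)
    {A : Set ℝ} (hA : A ∈ P) (g : ℝ → ℝ) :
    (∫ y in A, g y) / volume.real A * volume.real A = ∫ y in A, g y := by
  by_cases h : volume.real A = 0
  · have : volume A = 0 := (measureReal_eq_zero_iff (hP.volume_ne_top hA)).1 h
    simp [Measure.restrict_eq_zero.2 this]
  · field_simp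

theorem IsUnitPartition.lintegral_cellMean {P : Set (Set ℝ)} (hP : IsUnitPartition P)
    {g : ℝ → ℝ} (hg : Integrable g unitMeasure) (h0 : ∀ x, 0 ≤ g x) :
    ∫⁻ x, ENNReal.ofReal (cellMean P g x) ∂unitMeasure ≤ ∫⁻ x, ENNReal.ofReal (g x) ∂unitMeasure := by
  refine hP.lintegral_mono_cells fun A hA => ?_
  have hv : 0 ≤ (∫ y in A, g y) / volume.real A :=
    div_nonneg (integral_nonneg h0) measureReal_nonneg
  rw [lintegral_congr_ae ((hP.cellMean_ae g hA).mono fun x hx => by rw [hx]),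
    ← ofReal_integral_eq_lintegral_ofReal (hP.integrable_restrict hA hg) (ae_of_all _ h0),
    lintegral_const, Measure.restrict_apply_univ, ← ENNReal.ofReal_toReal (hP.volume_ne_top hA),
    ← ENNReal.ofReal_mul hv]
  exact ENNReal.ofReal_le_ofReal (hP.integral_div_mul_volume hA g).le

/-! ### Exponential and square-integrability estimates on cells. -/

/-- Invert `exp u ≥ 1 + u` at `u = x ^ 2 - x` and use `(1 + x + x ^ 2) * (1 - x + x ^ 2) = 1 + x ^ 2
+ x ^ 4 ≥ 1`. Validity for all real `x` is what makes bounded jumps unnecessary. -/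
theorem exp_sub_sq_le (x : ℝ) : Real.exp (x - x ^ 2) ≤ 1 + x + x ^ 2 := by
  have h1 : x ^ 2 - x + 1 ≤ Real.exp (x ^ 2 - x) := Real.add_one_le_exp _
  have h2 : 0 < x ^ 2 - x + 1 := by nlinarith [sq_nonneg (x - 1 / 2)]
  have h3 : Real.exp (x - x ^ 2) * Real.exp (x ^ 2 - x) = 1 := by
    rw [← Real.exp_add]; simp
  have h4 := Real.exp_pos (x - x ^ 2)
  have h5 : Real.exp (x - x ^ 2) * (x ^ 2 - x + 1) ≤ 1 := by
    exact (mul_le_mul_of_nonneg_left h1 h4.le).trans h3.le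
  have h6 : 1 ≤ (1 + x + x ^ 2) * (x ^ 2 - x + 1) := by nlinarith [sq_nonneg x, sq_nonneg (x ^ 2)]
  exact le_of_mul_le_mul_right (h5.trans h6) h2

/-- One step of the self-normalized exponential supermartingale. -/
theorem IsUnitPartition.lintegral_mul_exp_le {P : Set (Set ℝ)} (hP : IsUnitPartition P)
    {Z Y : ℝ → ℝ} (hZ : CellConst P Z) (hZ0 : ∀ x, 0 ≤ Z x) (hY : MemLp Y 2 unitMeasure)
    (hY0 : ∀ A ∈ P, ∫ x in A, Y x = 0) :
    ∫⁻ x, ENNReal.ofReal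
        (Z x * Real.exp (Y x - Y x ^ 2 - cellMean P (fun y => Y y ^ 2) x)) ∂unitMeasure
      ≤ ∫⁻ x, ENNReal.ofReal (Z x) ∂unitMeasure := by
  refine hP.lintegral_mono_cells fun A hA => ?_
  have := hP.isFiniteMeasure_restrict hA
  obtain ⟨z, hz⟩ := hZ A hA
  rcases eq_or_ne (volume A) 0 with hA0 | hA0
  · simp [Measure.restrict_eq_zero.2 hA0]
  -- The cell is not null, so the a.e. value `z` is attained at some point and inherits the sign of
  -- `Z`.
  have hz0 : 0 ≤ z := by
    have : (ae (volume.restrict A)).NeBot := by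
      rw [ae_neBot]; exact fun h => hA0 (Measure.restrict_eq_zero.1 h)
    obtain ⟨x, hx⟩ := hz.exists
    exact hx ▸ hZ0 x
  have i1 : Integrable Y (volume.restrict A) := hP.integrable_restrict hA (hY.integrable (by norm_num))
  have i2 : Integrable (fun x => Y x ^ 2) (volume.restrict A) :=
    hP.integrable_restrict hA hY.integrable_sq
  set v := (∫ y in A, Y y ^ 2) / volume.real A with hv
  have hvA : ∫ y in A, Y y ^ 2 = v * volume.real A := (hP.integral_div_mul_volume hA _).symm
  have i3 : Integrable (fun x => z * Real.exp (-v) * (1 + Y x + Y x ^ 2)) (volume.restrict A) :=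
    (((integrable_const _).add i1).add i2).const_mul _
  calc ∫⁻ x in A, ENNReal.ofReal
        (Z x * Real.exp (Y x - Y x ^ 2 - cellMean P (fun y => Y y ^ 2) x))
      ≤ ∫⁻ x in A, ENNReal.ofReal (z * Real.exp (-v) * (1 + Y x + Y x ^ 2)) := by
        refine lintegral_mono_ae ?_
        filter_upwards [hz, hP.cellMean_ae (fun y => Y y ^ 2) hA] with x h1 h2
        rw [h1, h2, ← hv]
        refine ENNReal.ofReal_le_ofReal ?_
        rw [sub_eq_add_neg _ v, Real.exp_add, mul_comm (Real.exp _), ← mul_assoc]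
        gcongr
        exact exp_sub_sq_le _
    _ = ENNReal.ofReal (∫ x in A, z * Real.exp (-v) * (1 + Y x + Y x ^ 2)) := by
        refine (ofReal_integral_eq_lintegral_ofReal i3 (ae_of_all _ fun x => ?_)).symm
        have : 0 ≤ 1 + Y x + Y x ^ 2 := (Real.exp_pos _).le.trans (exp_sub_sq_le _)
        positivity
    _ ≤ ENNReal.ofReal (z * volume.real A) := by
        refine ENNReal.ofReal_le_ofReal ?_
        have e1 : ∫ x in A, (1 + Y x + Y x ^ 2) = volume.real A + v * volume.real A := by
          rw [integral_add (f := fun x => 1 + Y x) ((integrable_const _).add i1) i2,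
            integral_add (integrable_const _) i1, hY0 A hA, hvA]
          simp
        rw [integral_const_mul, e1]
        have : Real.exp (-v) * (1 + v) ≤ 1 := by
          rw [Real.exp_neg, inv_mul_le_one₀ (Real.exp_pos _), add_comm]
          exact Real.add_one_le_exp v
        calc z * Real.exp (-v) * (volume.real A + v * volume.real A)
            = z * volume.real A * (Real.exp (-v) * (1 + v)) := by ring
          _ ≤ z * volume.real A * 1 := by gcongr
          _ = _ := mul_one _
    _ = ∫⁻ x in A, ENNReal.ofReal (Z x) := by
        rw [lintegral_congr_ae (hz.mono fun x hx => by rw [hx]), lintegral_const,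
          Measure.restrict_apply_univ, ENNReal.ofReal_mul hz0, measureReal_def,
          ENNReal.ofReal_toReal (hP.volume_ne_top hA)]

/-- A cellwise constant function with the same cell integrals as `p ∈ L²` is in `L²`. -/
theorem IsUnitPartition.memLp_two_of_integral_eq {P : Set (Set ℝ)} (hP : IsUnitPartition P)
    {p q : ℝ → ℝ} (hp : MemLp p 2 unitMeasure) (hq : CellConst P q)
    (h : ∀ A ∈ P, ∫ x in A, p x = ∫ x in A, q x) : MemLp q 2 unitMeasure := by
  have hqm := (hq.aemeasurable hP)
  rw [memLp_two_iff_integrable_sq hqm.aestronglyMeasurable]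
  refine ⟨(hqm.pow_const 2).aestronglyMeasurable, ?_⟩
  rw [hasFiniteIntegral_iff_ofReal (ae_of_all _ fun x => sq_nonneg _)]
  refine lt_of_le_of_lt (hP.lintegral_mono_cells (h := fun x => ENNReal.ofReal (p x ^ 2))
    fun A hA => ?_) ((hasFiniteIntegral_iff_ofReal (ae_of_all _ fun x => sq_nonneg _)).1
      hp.integrable_sq.2)
  have := hP.isFiniteMeasure_restrict hA
  obtain ⟨v, hv⟩ := hq A hA
  have i1 : Integrable p (volume.restrict A) := hP.integrable_restrict hA (hp.integrable (by norm_num))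
  have i2 : Integrable (fun x => p x ^ 2) (volume.restrict A) :=
    hP.integrable_restrict hA hp.integrable_sq
  have e1 : ∫ x in A, p x = volume.real A * v := by
    rw [h A hA, integral_congr_ae hv]; simp
  -- Nonnegative variance: as `v` is the mean of `p` on `A`, expanding gives `v ^ 2 * |A| ≤ ∫_A p ^
  -- 2`.
  have e2 : 0 ≤ ∫ x in A, (p x - v) ^ 2 := integral_nonneg fun x => sq_nonneg _
  have e3 : ∫ x in A, (p x - v) ^ 2 = ∫ x in A, p x ^ 2 - 2 * v * p x + v ^ 2 := by
    congr 1; ext x; ring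
  rw [e3, integral_add (f := fun x => p x ^ 2 - 2 * v * p x) (i2.sub (i1.const_mul _))
      (integrable_const _),
    integral_sub i2 (i1.const_mul _), integral_const_mul, e1] at e2
  rw [lintegral_congr_ae (hv.mono fun x hx => by rw [hx]),
    ← ofReal_integral_eq_lintegral_ofReal i2 (ae_of_all _ fun x => sq_nonneg _), lintegral_const,
    Measure.restrict_apply_univ, ← ENNReal.ofReal_toReal (hP.volume_ne_top hA),
    ← ENNReal.ofReal_mul (sq_nonneg _)]
  refine ENNReal.ofReal_le_ofReal ?_
  simp only [integral_const, measureReal_def, Measure.restrict_apply_univ, smul_eq_mul] at e2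
  linarith

/-! ### Filtrations and conditional squares. -/

namespace IsPartitionFiltration

variable {𝒜 : ℕ → Set (Set ℝ)}

theorem exists_eq_sUnion (h𝒜 : IsPartitionFiltration 𝒜) {i j : ℕ} (hij : i ≤ j) :
    ∀ A ∈ 𝒜 i, ∃ C ⊆ 𝒜 j, A = ⋃₀ C := by
  induction j, hij using Nat.le_induction with
  | base => exact fun A hA => ⟨{A}, by simpa using hA, by simp⟩
  | succ j hij ih =>
    intro A hA
    obtain ⟨C, hC, rfl⟩ := ih A hA
    choose! D hD hD' using h𝒜.refine_next j
    refine ⟨⋃ B ∈ C, D B, iUnion₂_subset fun B hB => hD B (hC hB), ?_⟩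
    ext x
    simp only [mem_sUnion, mem_iUnion]
    constructor
    · rintro ⟨B, hB, hx⟩
      rw [hD' B (hC hB)] at hx
      obtain ⟨E, hE, hxE⟩ := hx
      exact ⟨E, ⟨B, hB, hE⟩, hxE⟩
    · rintro ⟨E, ⟨B, hB, hE⟩, hxE⟩
      exact ⟨B, hB, by rw [hD' B (hC hB)]; exact ⟨E, hE, hxE⟩⟩

theorem cellConst_mono (h𝒜 : IsPartitionFiltration 𝒜) {i j : ℕ} (hij : i ≤ j) {g : ℝ → ℝ}
    (hg : CellConst (𝒜 i) g) : CellConst (𝒜 j) g := by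
  intro B hB
  rcases B.eq_empty_or_nonempty with rfl | ⟨x, hx⟩
  · exact ⟨0, by simp⟩
  have hx' : x ∈ ⋃₀ 𝒜 i := by
    rw [(h𝒜.partition i).sUnion_eq]; exact (h𝒜.partition j).subset_Ico hB hx
  obtain ⟨A, hA, hxA⟩ := hx'
  obtain ⟨v, hv⟩ := hg A hA
  obtain ⟨C, hC, rfl⟩ := h𝒜.exists_eq_sUnion hij A hA
  obtain ⟨E, hE, hxE⟩ := hxA
  have hBE : B = E := (h𝒜.partition j).disjoint.elim_set hB (hC hE) x hx hxE
  exact ⟨v, ae_mono (Measure.restrict_mono_set _ (hBE ▸ subset_sUnion_of_mem hE)) hv⟩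

end IsPartitionFiltration

/-- The conditional mean of `X j ^ 2` with respect to the preceding partition (`0` for `j = 0`). -/
noncomputable def condSq (𝒜 : ℕ → Set (Set ℝ)) (X : ℕ → ℝ → ℝ) : ℕ → ℝ → ℝ
  | 0 => fun _ => 0
  | j + 1 => cellMean (𝒜 j) fun y => X (j + 1) y ^ 2

theorem condSq_const_mul (𝒜 : ℕ → Set (Set ℝ)) (X : ℕ → ℝ → ℝ) (t : ℕ → ℝ) (j : ℕ) (x : ℝ) :
    condSq 𝒜 (fun j x => t j * X j x) j x = t j ^ 2 * condSq 𝒜 X j x := by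
  cases j with
  | zero => simp [condSq]
  | succ j => simp only [condSq, mul_pow, cellMean_const_mul]

theorem condSq_nonneg (𝒜 : ℕ → Set (Set ℝ)) (X : ℕ → ℝ → ℝ) (j : ℕ) (x : ℝ) :
    0 ≤ condSq 𝒜 X j x := by
  cases j with
  | zero => simp [condSq]
  | succ j => exact cellMean_nonneg _ (fun _ => sq_nonneg _) x

theorem IsPartitionFiltration.cellConst_condSq {𝒜 : ℕ → Set (Set ℝ)}
    (h𝒜 : IsPartitionFiltration 𝒜) (X : ℕ → ℝ → ℝ) (j : ℕ) : CellConst (𝒜 j) (condSq 𝒜 X j) := by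
  cases j with
  | zero => exact CellConst.const 0
  | succ j => exact h𝒜.cellConst_mono j.le_succ ((h𝒜.partition j).cellConst_cellMean _)

theorem IsPartitionFiltration.lintegral_condSq_le {𝒜 : ℕ → Set (Set ℝ)}
    (h𝒜 : IsPartitionFiltration 𝒜) {X : ℕ → ℝ → ℝ} {j : ℕ} (hX : MemLp (X j) 2 unitMeasure) :
    ∫⁻ x, ENNReal.ofReal (condSq 𝒜 X j x) ∂unitMeasure
      ≤ ∫⁻ x, ENNReal.ofReal (X j x ^ 2) ∂unitMeasure := by
  cases j with
  | zero => simp [condSq]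
  | succ j => exact (h𝒜.partition j).lintegral_cellMean hX.integrable_sq fun _ => sq_nonneg _

/-! ### Martingale differences: orthogonality, tails and a maximal inequality. -/

namespace IsMartingaleDifferenceOn

variable {𝒜 : ℕ → Set (Set ℝ)} {X : ℕ → ℝ → ℝ}

theorem const_mul (hX : IsMartingaleDifferenceOn 𝒜 X) (t : ℕ → ℝ) :
    IsMartingaleDifferenceOn 𝒜 fun j x => t j * X j x where
  integrable n := (hX.integrable n).const_mul _
  const_on n := CellConst.comp (hX.const_on n) (t n * ·)
  integral_eq_zero n A hA := by rw [integral_const_mul, hX.integral_eq_zero n A hA, mul_zero]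

theorem setIntegral_eq_zero (h𝒜 : IsPartitionFiltration 𝒜) (hX : IsMartingaleDifferenceOn 𝒜 X)
    {i j : ℕ} (hij : i < j) {A : Set ℝ} (hA : A ∈ 𝒜 i) : ∫ x in A, X j x = 0 := by
  obtain ⟨k, rfl⟩ : ∃ k, j = k + 1 := ⟨j - 1, by omega⟩
  obtain ⟨C, hC, rfl⟩ := h𝒜.exists_eq_sUnion (Nat.lt_succ_iff.1 hij) A hA
  exact (h𝒜.partition k).integral_sUnion_eq_zero hC (hX.integrable _)
    fun B hB => hX.integral_eq_zero k B (hC hB)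

theorem integral_mul_eq_zero_of_lt (h𝒜 : IsPartitionFiltration 𝒜)
    (hX : IsMartingaleDifferenceOn 𝒜 X) (hX2 : ∀ j, MemLp (X j) 2 unitMeasure) {i j : ℕ}
    (hij : i < j) : ∫ x, X i x * X j x ∂unitMeasure = 0 := by
  refine (h𝒜.partition i).integral_eq_zero ((hX2 i).integrable_mul (hX2 j)) fun A hA => ?_
  obtain ⟨v, hv⟩ := hX.const_on i A hA
  rw [integral_congr_ae (hv.mono fun x hx => by rw [hx]), integral_const_mul,
    hX.setIntegral_eq_zero h𝒜 hij hA, mul_zero]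

theorem integral_mul_eq_zero (h𝒜 : IsPartitionFiltration 𝒜)
    (hX : IsMartingaleDifferenceOn 𝒜 X) (hX2 : ∀ j, MemLp (X j) 2 unitMeasure) {i j : ℕ}
    (hij : i ≠ j) : ∫ x, X i x * X j x ∂unitMeasure = 0 := by
  rcases hij.lt_or_gt with h | h
  · exact hX.integral_mul_eq_zero_of_lt h𝒜 hX2 h
  · simp_rw [mul_comm (X i _)]
    exact hX.integral_mul_eq_zero_of_lt h𝒜 hX2 h

/-- If a martingale difference polynomial is in `L²`, so are all its terms. -/
theorem memLp_two_of_sum (h𝒜 : IsPartitionFiltration 𝒜) (hX : IsMartingaleDifferenceOn 𝒜 X)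
    (s : Finset ℕ) (hs : MemLp (fun x => ∑ i ∈ s, X i x) 2 unitMeasure) {k : ℕ} (hk : k ∈ s) :
    MemLp (X k) 2 unitMeasure := by
  -- The terms of index at most `k` form the conditional expectation of the whole sum on `𝒜 k`,
  -- which stays in `L²`; `X k` is the difference of two consecutive truncations.
  have key : ∀ k, MemLp (fun x => ∑ i ∈ s with i < k, X i x) 2 unitMeasure := by
    intro k
    cases k with
    | zero => simp
    | succ k =>
      refine (h𝒜.partition k).memLp_two_of_integral_eq hs ?_ fun A hA => ?_
      · refine CellConst.sum _ fun i hi => h𝒜.cellConst_mono (i := i) ?_ (hX.const_on i)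
        have := (Finset.mem_filter.1 hi).2
        omega
      · have hi : ∀ i, Integrable (X i) (volume.restrict A) := fun i =>
          (h𝒜.partition k).integrable_restrict hA (hX.integrable i)
        rw [integral_finsetSum _ fun i _ => hi i, integral_finsetSum _ fun i _ => hi i,
          Finset.sum_filter]
        refine Finset.sum_congr rfl fun i _ => ?_
        split_ifs with h
        · rfl
        · exact hX.setIntegral_eq_zero h𝒜 (by omega) hA
  have := (key (k + 1)).sub (key k)
  convert this using 1
  ext x
  have e : s.filter (· < k + 1) = insert k (s.filter (· < k)) := by
    ext i
    simp only [Finset.mem_filter, Finset.mem_insert]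
    constructor
    · rintro ⟨h1, h2⟩
      rcases Nat.lt_succ_iff_lt_or_eq.1 h2 with h | h
      · exact Or.inr ⟨h1, h⟩
      · exact Or.inl h
    · rintro (rfl | ⟨h1, h2⟩)
      · exact ⟨hk, by omega⟩
      · exact ⟨h1, by omega⟩
  simp only [Pi.sub_apply]
  rw [e, Finset.sum_insert (by simp), add_sub_cancel_right]

theorem memLp_sum (hX2 : ∀ j, MemLp (X j) 2 unitMeasure) (s : Finset ℕ) :
    MemLp (fun x => ∑ i ∈ s, X i x) 2 unitMeasure :=
  memLp_finsetSum s fun i _ => hX2 i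

theorem integral_sum_mul_sum_eq_zero (h𝒜 : IsPartitionFiltration 𝒜)
    (hX : IsMartingaleDifferenceOn 𝒜 X) (hX2 : ∀ j, MemLp (X j) 2 unitMeasure) {s t : Finset ℕ}
    (hst : Disjoint s t) :
    ∫ x, (∑ i ∈ s, X i x) * ∑ j ∈ t, X j x ∂unitMeasure = 0 := by
  have hint : ∀ i j, Integrable (fun x => X i x * X j x) unitMeasure := fun i j =>
    (hX2 i).integrable_mul (hX2 j)
  simp_rw [Finset.sum_mul_sum]
  rw [integral_finsetSum _ fun i _ => integrable_finsetSum _ fun j _ => hint i j]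
  refine Finset.sum_eq_zero fun i hi => ?_
  rw [integral_finsetSum _ fun j _ => hint i j]
  exact Finset.sum_eq_zero fun j hj =>
    hX.integral_mul_eq_zero h𝒜 hX2 (Finset.disjoint_iff_ne.1 hst i hi j hj)

theorem integral_sum_sq (h𝒜 : IsPartitionFiltration 𝒜)
    (hX : IsMartingaleDifferenceOn 𝒜 X) (hX2 : ∀ j, MemLp (X j) 2 unitMeasure) (s : Finset ℕ) :
    ∫ x, (∑ i ∈ s, X i x) ^ 2 ∂unitMeasure = ∑ i ∈ s, ∫ x, X i x ^ 2 ∂unitMeasure := by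
  have hint : ∀ i j, Integrable (fun x => X i x * X j x) unitMeasure := fun i j =>
    (hX2 i).integrable_mul (hX2 j)
  simp_rw [sq, Finset.sum_mul_sum]
  rw [integral_finsetSum _ fun i _ => integrable_finsetSum _ fun j _ => hint i j]
  refine Finset.sum_congr rfl fun i hi => ?_
  rw [integral_finsetSum _ fun j _ => hint i j]
  exact Finset.sum_eq_single_of_mem i hi fun j _ hj => hX.integral_mul_eq_zero h𝒜 hX2 hj.symm

/-- A self-normalized exponential inequality: no bound on the jumps is required. -/
theorem lintegral_exp_le (h𝒜 : IsPartitionFiltration 𝒜) (hX : IsMartingaleDifferenceOn 𝒜 X)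
    (hX2 : ∀ j, MemLp (X j) 2 unitMeasure) (N : ℕ) :
    ∫⁻ x, ENNReal.ofReal (Real.exp
      (∑ j ∈ Finset.range (N + 1), (X j x - X j x ^ 2 - condSq 𝒜 X j x))) ∂unitMeasure ≤ 2 := by
  induction N with
  | zero =>
    -- `X 0` is not assumed centred, so only the pointwise bound `y - y ^ 2 ≤ 1 / 4 < log 2` is
    -- used; this is where the constant `2` comes from.
    have h : ∀ x, ENNReal.ofReal (Real.exp
        (∑ j ∈ Finset.range (0 + 1), (X j x - X j x ^ 2 - condSq 𝒜 X j x))) ≤ 2 := by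
      intro x
      simp only [zero_add, Finset.range_one, Finset.sum_singleton, condSq, sub_zero]
      rw [← ENNReal.ofReal_ofNat 2]
      refine ENNReal.ofReal_le_ofReal ?_
      rw [← Real.le_log_iff_exp_le (by norm_num)]
      nlinarith [Real.log_two_gt_d9, sq_nonneg (X 0 x - 1 / 2)]
    exact (lintegral_mono h).trans (by simp)
  | succ N ih =>
    refine le_trans (le_of_eq ?_) (((h𝒜.partition N).lintegral_mul_exp_le
      (Z := fun x => Real.exp
        (∑ j ∈ Finset.range (N + 1), (X j x - X j x ^ 2 - condSq 𝒜 X j x))) (Y := X (N + 1))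
      ?_ (fun x => (Real.exp_pos _).le) (hX2 _) (hX.integral_eq_zero N)).trans ih)
    · refine lintegral_congr fun x => ?_
      rw [Finset.sum_range_succ _ (N + 1), Real.exp_add]
      rfl
    · refine CellConst.comp (CellConst.sum _ fun j hj => ?_) Real.exp
      refine h𝒜.cellConst_mono (i := j) (Nat.lt_succ_iff.1 (Finset.mem_range.1 hj)) ?_
      exact CellConst.comp₂ (CellConst.comp (hX.const_on j) fun y => y - y ^ 2)
        (h𝒜.cellConst_condSq X j) (· - ·)

theorem aemeasurable (h𝒜 : IsPartitionFiltration 𝒜) (hX : IsMartingaleDifferenceOn 𝒜 X) (j : ℕ) :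
    AEMeasurable (X j) unitMeasure :=
  CellConst.aemeasurable (h𝒜.partition j) (hX.const_on j)

/-- One-sided subgaussian tail bound for a partial sum over `H`, on the set where the square function
and the conditional square function over `J ⊇ H` are small. -/
theorem measure_sum_ge_le (h𝒜 : IsPartitionFiltration 𝒜) (hX : IsMartingaleDifferenceOn 𝒜 X)
    (hX2 : ∀ j, MemLp (X j) 2 unitMeasure) {H J : Finset ℕ} (hHJ : H ⊆ J) {L lam : ℝ}
    (hL : 0 < L) (hlam : 0 < lam) :
    unitMeasure {x | 5 * lam ≤ ∑ j ∈ H, X j x ∧ ∑ j ∈ J, X j x ^ 2 ≤ lam ^ 2 / L ∧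
      ∑ j ∈ J, condSq 𝒜 X j x ≤ lam ^ 2 / L} ≤ ENNReal.ofReal (2 * Real.exp (-(3 * L))) := by
  obtain ⟨N, hN⟩ : ∃ N, H ⊆ Finset.range (N + 1) :=
    ⟨H.sup id, fun i hi => Finset.mem_range.2 (Nat.lt_succ_iff.2 (Finset.le_sup (f := id) hi))⟩
  -- Zero weights delete the indices outside `H`, so `H` need not be an interval. With scale `L /
  -- lam` the exponent on the event is at least `5 * L - L - L = 3 * L`.
  set t : ℕ → ℝ := fun j => if j ∈ H then L / lam else 0 with ht
  have hY := hX.const_mul t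
  have hbound := hY.lintegral_exp_le h𝒜 (fun j => (hX2 j).const_mul (t j)) N
  have hsum : ∀ x, ∑ j ∈ Finset.range (N + 1), (t j * X j x - (t j * X j x) ^ 2 -
      condSq 𝒜 (fun j x => t j * X j x) j x) = (L / lam) * ∑ j ∈ H, X j x -
      (L / lam) ^ 2 * ∑ j ∈ H, X j x ^ 2 - (L / lam) ^ 2 * ∑ j ∈ H, condSq 𝒜 X j x := by
    intro x
    rw [Finset.mul_sum, Finset.mul_sum, Finset.mul_sum, ← Finset.sum_sub_distrib,
      ← Finset.sum_sub_distrib, ← Finset.sum_subset hN]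
    · refine Finset.sum_congr rfl fun j hj => ?_
      rw [condSq_const_mul]
      simp only [ht, if_pos hj]
      ring
    · intro j _ hj
      rw [condSq_const_mul]
      simp [ht, hj]
  simp_rw [hsum] at hbound
  have hmeas : AEMeasurable (fun x => ENNReal.ofReal (Real.exp ((L / lam) * ∑ j ∈ H, X j x -
      (L / lam) ^ 2 * ∑ j ∈ H, X j x ^ 2 - (L / lam) ^ 2 * ∑ j ∈ H, condSq 𝒜 X j x)))
      unitMeasure := by
    refine (Real.measurable_exp.comp_aemeasurable ((AEMeasurable.sub ?_ ?_).sub ?_)).ennreal_ofReal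
    · exact (Finset.aemeasurable_fun_sum _ fun j _ => hX.aemeasurable h𝒜 j).const_mul _
    · exact (Finset.aemeasurable_fun_sum _ fun j _ =>
        (hX.aemeasurable h𝒜 j).pow_const 2).const_mul _
    · exact (Finset.aemeasurable_fun_sum _ fun j _ =>
        (h𝒜.cellConst_condSq X j).aemeasurable (h𝒜.partition j)).const_mul _
  have hmarkov := (mul_meas_ge_le_lintegral₀ hmeas (ENNReal.ofReal (Real.exp (3 * L)))).trans hbound
  have hsub : {x | 5 * lam ≤ ∑ j ∈ H, X j x ∧ ∑ j ∈ J, X j x ^ 2 ≤ lam ^ 2 / L ∧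
      ∑ j ∈ J, condSq 𝒜 X j x ≤ lam ^ 2 / L} ⊆ {x | ENNReal.ofReal (Real.exp (3 * L)) ≤
      ENNReal.ofReal (Real.exp ((L / lam) * ∑ j ∈ H, X j x -
      (L / lam) ^ 2 * ∑ j ∈ H, X j x ^ 2 - (L / lam) ^ 2 * ∑ j ∈ H, condSq 𝒜 X j x))} := by
    rintro x ⟨h1, h2, h3⟩
    refine ENNReal.ofReal_le_ofReal (Real.exp_le_exp.2 ?_)
    have h2' := (Finset.sum_le_sum_of_subset_of_nonneg hHJ
      (f := fun j => X j x ^ 2) fun _ _ _ => sq_nonneg _).trans h2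
    have h3' := (Finset.sum_le_sum_of_subset_of_nonneg hHJ
      (f := fun j => condSq 𝒜 X j x) fun j _ _ => condSq_nonneg 𝒜 X j x).trans h3
    have e1 : L / lam * (5 * lam) = 5 * L := by field_simp
    have e2 : (L / lam) ^ 2 * (lam ^ 2 / L) = L := by field_simp
    have i1 := mul_le_mul_of_nonneg_left h1 (show 0 ≤ L / lam by positivity)
    have i2 := mul_le_mul_of_nonneg_left h2' (show 0 ≤ (L / lam) ^ 2 by positivity)
    have i3 := mul_le_mul_of_nonneg_left h3' (show 0 ≤ (L / lam) ^ 2 by positivity)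
    linarith
  refine (measure_mono hsub).trans ?_
  rw [Real.exp_neg, ← div_eq_mul_inv, ENNReal.ofReal_div_of_pos (Real.exp_pos _),
    ENNReal.ofReal_ofNat, ENNReal.le_div_iff_mul_le (by simp [Real.exp_pos]) (by simp), mul_comm]
  exact hmarkov

/-- Maximal inequality for the partial sums over a family of subsets of `J`. -/
theorem measure_max_ge_le (h𝒜 : IsPartitionFiltration 𝒜) (hX : IsMartingaleDifferenceOn 𝒜 X)
    (hX2 : ∀ j, MemLp (X j) 2 unitMeasure) {ι : Type*} (I : Finset ι) {H : ι → Finset ℕ}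
    {J : Finset ℕ} (hHJ : ∀ i ∈ I, H i ⊆ J) {L lam : ℝ} (hL : 0 < L) (hlam : 0 < lam) :
    unitMeasure {x | ∃ i ∈ I, 5 * lam ≤ |∑ j ∈ H i, X j x|} ≤
      ENNReal.ofReal (2 * L / lam ^ 2 * ∑ j ∈ J, ∫ x, X j x ^ 2 ∂unitMeasure
        + I.card * (4 * Real.exp (-(3 * L)))) := by
  -- Markov's inequality, stated for a general `W` to serve both square functions of `J`. Their
  -- exceptional sets do not depend on `i`, so they are paid for once, outside the union bound.
  have hS : ∀ (W : ℕ → ℝ → ℝ), (∀ j x, 0 ≤ W j x) → (∀ j, AEMeasurable (W j) unitMeasure) →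
      (∀ j, ∫⁻ x, ENNReal.ofReal (W j x) ∂unitMeasure
        ≤ ∫⁻ x, ENNReal.ofReal (X j x ^ 2) ∂unitMeasure) →
      unitMeasure {x | lam ^ 2 / L ≤ ∑ j ∈ J, W j x} ≤
        ENNReal.ofReal (L / lam ^ 2 * ∑ j ∈ J, ∫ x, X j x ^ 2 ∂unitMeasure) := by
    intro W hW0 hWm hWle
    have hm : AEMeasurable (fun x => ENNReal.ofReal (∑ j ∈ J, W j x)) unitMeasure :=
      (Finset.aemeasurable_fun_sum _ fun j _ => hWm j).ennreal_ofReal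
    have h1 := mul_meas_ge_le_lintegral₀ hm (ENNReal.ofReal (lam ^ 2 / L))
    have h2 : ∫⁻ x, ENNReal.ofReal (∑ j ∈ J, W j x) ∂unitMeasure ≤
        ENNReal.ofReal (∑ j ∈ J, ∫ x, X j x ^ 2 ∂unitMeasure) := by
      simp_rw [ENNReal.ofReal_sum_of_nonneg fun j (_ : j ∈ J) => hW0 j _]
      rw [lintegral_finsetSum' _ fun j _ => (hWm j).ennreal_ofReal,
        ENNReal.ofReal_sum_of_nonneg fun j _ => integral_nonneg fun x => sq_nonneg _]
      refine Finset.sum_le_sum fun j _ => (hWle j).trans (le_of_eq ?_)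
      exact (ofReal_integral_eq_lintegral_ofReal (hX2 j).integrable_sq
        (ae_of_all _ fun x => sq_nonneg _)).symm
    have e : L / lam ^ 2 = (lam ^ 2 / L)⁻¹ := by rw [inv_div]
    rw [e, mul_comm, ← div_eq_mul_inv, ENNReal.ofReal_div_of_pos (by positivity),
      ENNReal.le_div_iff_mul_le (Or.inl (by simp; positivity)) (by simp), mul_comm]
    refine le_trans ?_ (h1.trans h2)
    gcongr with x
    exact ENNReal.ofReal_le_ofReal
  have hS1 := hS (fun j x => X j x ^ 2) (fun _ _ => sq_nonneg _)
    (fun j => (hX.aemeasurable h𝒜 j).pow_const 2) fun j => le_rfl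
  have hS2 := hS (condSq 𝒜 X) (condSq_nonneg 𝒜 X)
    (fun j => (h𝒜.cellConst_condSq X j).aemeasurable (h𝒜.partition j))
    fun j => h𝒜.lintegral_condSq_le (hX2 j)
  have hneg := hX.const_mul fun _ => -1
  -- Absolute values are handled by applying the one-sided bound to `X` and to `-X`.
  set B : ι → Set ℝ := fun i =>
    {x | 5 * lam ≤ ∑ j ∈ H i, X j x ∧ ∑ j ∈ J, X j x ^ 2 ≤ lam ^ 2 / L ∧
      ∑ j ∈ J, condSq 𝒜 X j x ≤ lam ^ 2 / L} ∪
    {x | 5 * lam ≤ ∑ j ∈ H i, -1 * X j x ∧ ∑ j ∈ J, (-1 * X j x) ^ 2 ≤ lam ^ 2 / L ∧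
      ∑ j ∈ J, condSq 𝒜 (fun j x => -1 * X j x) j x ≤ lam ^ 2 / L} with hB
  have hBle : ∀ i ∈ I, unitMeasure (B i) ≤ ENNReal.ofReal (4 * Real.exp (-(3 * L))) := by
    intro i hi
    refine (measure_union_le _ _).trans ?_
    have e : 4 * Real.exp (-(3 * L)) = 2 * Real.exp (-(3 * L)) + 2 * Real.exp (-(3 * L)) := by ring
    rw [e, ENNReal.ofReal_add (by positivity) (by positivity)]
    exact add_le_add (hX.measure_sum_ge_le h𝒜 hX2 (hHJ i hi) hL hlam)
      (hneg.measure_sum_ge_le h𝒜 (fun j => (hX2 j).const_mul _) (hHJ i hi) hL hlam)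
  have hsub : {x | ∃ i ∈ I, 5 * lam ≤ |∑ j ∈ H i, X j x|} ⊆
      ({x | lam ^ 2 / L ≤ ∑ j ∈ J, X j x ^ 2} ∪ {x | lam ^ 2 / L ≤ ∑ j ∈ J, condSq 𝒜 X j x}) ∪
      ⋃ i ∈ I, B i := by
    rintro x ⟨i, hi, hx⟩
    by_cases h1 : lam ^ 2 / L ≤ ∑ j ∈ J, X j x ^ 2
    · exact Or.inl (Or.inl h1)
    by_cases h2 : lam ^ 2 / L ≤ ∑ j ∈ J, condSq 𝒜 X j x
    · exact Or.inl (Or.inr h2)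
    refine Or.inr (mem_iUnion₂.2 ⟨i, hi, ?_⟩)
    push Not at h1 h2
    rcases le_abs.1 hx with h | h
    · exact Or.inl ⟨h, h1.le, h2.le⟩
    · refine Or.inr ⟨?_, ?_, ?_⟩
      · rw [← Finset.mul_sum]; linarith
      · simpa using h1.le
      · simp_rw [condSq_const_mul 𝒜 X fun _ => -1]
        simpa using h2.le
  refine (measure_mono hsub).trans ((measure_union_le _ _).trans ?_)
  have hA : 0 ≤ ∑ j ∈ J, ∫ x, X j x ^ 2 ∂unitMeasure :=
    Finset.sum_nonneg fun j _ => integral_nonneg fun x => sq_nonneg _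
  rw [ENNReal.ofReal_add (by positivity) (by positivity)]
  refine add_le_add ((measure_union_le _ _).trans ((add_le_add hS1 hS2).trans (le_of_eq ?_))) ?_
  · rw [← ENNReal.ofReal_add (by positivity) (by positivity)]
    congr 1; ring
  · refine (measure_biUnion_finset_le _ _).trans ((Finset.sum_le_sum hBle).trans (le_of_eq ?_))
    rw [Finset.sum_const, nsmul_eq_mul, ← ENNReal.ofReal_natCast I.card,
      ← ENNReal.ofReal_mul (by positivity)]

end IsMartingaleDifferenceOn

/-! ### Convergence along blocks and numerical estimates. -/

theorem sum_range_add_sum_blocks {N : ℕ → ℕ} (hN : Monotone N) (u : ℕ → ℝ) (K : ℕ) :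
    ∑ n ∈ Finset.range (N 0), u n + ∑ k ∈ Finset.range K, ∑ n ∈ Finset.Ico (N k) (N (k + 1)), u n
      = ∑ n ∈ Finset.range (N K), u n := by
  induction K with
  | zero => simp
  | succ K ih =>
    rw [Finset.sum_range_succ, ← add_assoc, ih]
    exact Finset.sum_range_add_sum_Ico u (hN K.le_succ)

/-- A series converges if its block sums are absolutely summable and the oscillation of the
partial sums inside the blocks tends to zero. -/
theorem tendsto_sum_range_of_blocks {N : ℕ → ℕ} (hN : StrictMono N) {u : ℕ → ℝ}
    (hsum : Summable fun k => ∑ n ∈ Finset.Ico (N k) (N (k + 1)), u n)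
    (hosc : ∀ ε > 0, ∀ᶠ k in atTop, ∀ m ∈ Finset.Icc (N k) (N (k + 1)),
      |∑ n ∈ Finset.Ico (N k) m, u n| < ε) :
    ∃ s : ℝ, Tendsto (fun M => ∑ n ∈ Finset.range M, u n) atTop (𝓝 s) := by
  have h1 := hsum.hasSum.tendsto_sum_nat.const_add (∑ n ∈ Finset.range (N 0), u n)
  simp_rw [sum_range_add_sum_blocks hN.monotone] at h1
  refine ⟨∑ n ∈ Finset.range (N 0), u n + ∑' k, ∑ n ∈ Finset.Ico (N k) (N (k + 1)), u n,
    Metric.tendsto_atTop.2 fun ε hε => ?_⟩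
  obtain ⟨K₁, hK₁⟩ := Metric.tendsto_atTop.1 h1 (ε / 2) (half_pos hε)
  obtain ⟨K₂, hK₂⟩ := eventually_atTop.1 (hosc (ε / 2) (half_pos hε))
  refine ⟨N (max K₁ K₂), fun M hM => ?_⟩
  have hex : ∃ j, M < N j := ⟨M + 1, lt_of_lt_of_le M.lt_succ_self (hN.le_apply)⟩
  classical
  have hlt := Nat.find_spec hex
  have hgt : max K₁ K₂ < Nat.find hex := by
    by_contra! h
    exact absurd (hlt.trans_le (hN.monotone h)) (not_lt.2 hM)
  -- The first endpoint beyond `M` is `N (k + 1)`, so `M` lies in block `k`.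
  obtain ⟨k, hk⟩ : ∃ k, Nat.find hex = k + 1 := ⟨Nat.find hex - 1, by omega⟩
  have hkM : N k ≤ M := not_lt.1 (Nat.find_min hex (by omega))
  rw [hk] at hlt hgt
  have i1 := hK₁ k (by omega)
  have i2 := hK₂ k (by omega) M (Finset.mem_Icc.2 ⟨hkM, hlt.le⟩)
  rw [Real.dist_eq] at i1 ⊢
  rw [← Finset.sum_range_add_sum_Ico u hkM]
  rw [abs_lt] at *
  constructor <;> linarith [i1.1, i1.2, i2.1, i2.2]

/-- The endpoints `2 ^ 2 ^ k - 1` of lacunary blocks on which `log₂ (n + 1) ≥ 2 ^ k`. -/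
def blockEnd (k : ℕ) : ℕ := 2 ^ 2 ^ k - 1

theorem blockEnd_add_one (k : ℕ) : blockEnd k + 1 = 2 ^ 2 ^ k :=
  Nat.sub_add_cancel Nat.one_le_two_pow

theorem strictMono_blockEnd : StrictMono blockEnd := fun i j hij => by
  have h : 2 ^ 2 ^ i < 2 ^ 2 ^ j :=
    Nat.pow_lt_pow_right (by norm_num) (Nat.pow_lt_pow_right (by norm_num) hij)
  rw [← blockEnd_add_one, ← blockEnd_add_one] at h
  omega

theorem two_pow_le_logb {k n : ℕ} (h : blockEnd k ≤ n) :
    (2 : ℝ) ^ k ≤ Real.logb 2 ((n : ℝ) + 1) := by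
  have h1 : 2 ^ 2 ^ k ≤ n + 1 := by rw [← blockEnd_add_one]; omega
  have h2 : (2 : ℝ) ^ 2 ^ k ≤ (n : ℝ) + 1 := by exact_mod_cast h1
  rw [Real.le_logb_iff_rpow_le (by norm_num) (by positivity)]
  calc (2 : ℝ) ^ ((2 : ℝ) ^ k) = 2 ^ 2 ^ k := by
        rw [← Real.rpow_natCast 2 (2 ^ k)]; push_cast; rfl
    _ ≤ _ := h2

theorem logb_add_one_nonneg (n : ℕ) : 0 ≤ Real.logb 2 ((n : ℝ) + 1) :=
  Real.logb_nonneg (by norm_num) (by linarith [(Nat.cast_nonneg n : (0 : ℝ) ≤ n)])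

/-- The block has at most `2 ^ 2 ^ (k + 1) ≤ exp (2 * 2 ^ k)` partial sums, so the rate `3` in the
tail leaves a summable `exp (-2 ^ k)`. -/
theorem card_block_mul_exp_le (k : ℕ) :
    ((Finset.Icc (blockEnd k) (blockEnd (k + 1))).card : ℝ) * (4 * Real.exp (-(3 * 2 ^ k)))
      ≤ 4 * (1 / 2) ^ k := by
  have h1 : (Finset.Icc (blockEnd k) (blockEnd (k + 1))).card ≤ 2 ^ 2 ^ (k + 1) := by
    rw [Nat.card_Icc, blockEnd_add_one]; exact Nat.sub_le _ _
  have h2 : ((Finset.Icc (blockEnd k) (blockEnd (k + 1))).card : ℝ) ≤ 2 ^ 2 ^ (k + 1) := by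
    exact_mod_cast h1
  have h3 : (2 : ℝ) ^ 2 ^ (k + 1) ≤ Real.exp (2 * 2 ^ k) := by
    have : (2 : ℝ) ≤ Real.exp 1 := by linarith [Real.add_one_le_exp 1]
    calc (2 : ℝ) ^ 2 ^ (k + 1) ≤ Real.exp 1 ^ 2 ^ (k + 1) := by gcongr
      _ = Real.exp (2 * 2 ^ k) := by
        rw [← Real.exp_nat_mul, mul_one]; push_cast; rw [pow_succ']
  have h4 : Real.exp (-(2 ^ k)) ≤ (1 / 2 : ℝ) ^ k := by
    rw [Real.exp_neg, one_div, inv_pow]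
    gcongr
    linarith [Real.add_one_le_exp ((2 : ℝ) ^ k)]
  calc _ ≤ Real.exp (2 * 2 ^ k) * (4 * Real.exp (-(3 * 2 ^ k))) := by gcongr; exact h2.trans h3
    _ = 4 * Real.exp (-(2 ^ k)) := by
      rw [mul_left_comm, ← Real.exp_add]; congr 2; ring
    _ ≤ _ := by gcongr

/-! ### Almost everywhere convergence. -/

namespace IsMartingaleDifferenceOn

variable {𝒜 : ℕ → Set (Set ℝ)} {X : ℕ → ℝ → ℝ}

/-- Almost everywhere convergence of a series of non-overlapping martingale difference
polynomials, under a logarithmic weight condition on the `L²` norms. -/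
theorem ae_tendsto_sum (h𝒜 : IsPartitionFiltration 𝒜) (hX : IsMartingaleDifferenceOn 𝒜 X)
    (hX2 : ∀ j, MemLp (X j) 2 unitMeasure) {G : ℕ → Finset ℕ}
    (hG : ∀ m n, m ≠ n → Disjoint (G m) (G n))
    (hsum : Summable fun n : ℕ =>
      (∫ x, (∑ j ∈ G n, X j x) ^ 2 ∂unitMeasure) * Real.logb 2 ((n : ℝ) + 1)) :
    ∀ᵐ x ∂unitMeasure, ∃ s : ℝ,
      Tendsto (fun N => ∑ n ∈ Finset.range N, ∑ j ∈ G n, X j x) atTop (𝓝 s) := by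
  set U : ℕ → ℕ → Finset ℕ := fun k m => (Finset.Ico (blockEnd k) m).biUnion G with hU
  have hUsum : ∀ k m (w : ℕ → ℝ),
      ∑ n ∈ Finset.Ico (blockEnd k) m, ∑ j ∈ G n, w j = ∑ j ∈ U k m, w j := fun k m w =>
    (Finset.sum_biUnion fun i _ j _ hij => hG i j hij).symm
  set b : ℕ → ℝ → ℝ := fun k x => ∑ j ∈ U k (blockEnd (k + 1)), X j x with hb
  set E : ℕ → ℝ := fun k => ∑ j ∈ U k (blockEnd (k + 1)), ∫ x, X j x ^ 2 ∂unitMeasure with hE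
  have hEb : ∀ k, ∫ x, b k x ^ 2 ∂unitMeasure = E k := fun k => hX.integral_sum_sq h𝒜 hX2 _
  have hE0 : ∀ k, 0 ≤ E k := fun k =>
    Finset.sum_nonneg fun j _ => integral_nonneg fun x => sq_nonneg _
  have hg0 : ∀ n : ℕ, 0 ≤ (∫ x, (∑ j ∈ G n, X j x) ^ 2 ∂unitMeasure) *
      Real.logb 2 ((n : ℝ) + 1) := fun n =>
    mul_nonneg (integral_nonneg fun x => sq_nonneg _) (logb_add_one_nonneg n)
  have hEsum : Summable fun k => 2 ^ k * E k := by
    refine summable_of_sum_range_le (c := ∑' n : ℕ, (∫ x, (∑ j ∈ G n, X j x) ^ 2 ∂unitMeasure) *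
      Real.logb 2 ((n : ℝ) + 1)) (fun k => mul_nonneg (by positivity) (hE0 k)) fun K => ?_
    refine le_trans ?_ (hsum.sum_le_tsum (Finset.range (blockEnd K)) fun n _ => hg0 n)
    rw [← sum_range_add_sum_blocks strictMono_blockEnd.monotone]
    refine le_trans (Finset.sum_le_sum fun k _ => ?_)
      (le_add_of_nonneg_left (Finset.sum_nonneg fun n _ => hg0 n))
    simp only [hE]
    rw [← hUsum k _ fun j => ∫ x, X j x ^ 2 ∂unitMeasure, Finset.mul_sum]
    refine Finset.sum_le_sum fun n hn => ?_
    rw [hX.integral_sum_sq h𝒜 hX2, mul_comm]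
    exact mul_le_mul_of_nonneg_left (two_pow_le_logb (Finset.mem_Ico.1 hn).1)
      (Finset.sum_nonneg fun j _ => integral_nonneg fun x => sq_nonneg _)
  have hbsum : ∀ᵐ x ∂unitMeasure, Summable fun k => b k x := by
    have hi : ∀ k, Integrable (fun x => 2 ^ k * b k x ^ 2) unitMeasure := fun k =>
      ((memLp_sum hX2 _).integrable_sq).const_mul _
    have hlt : ∫⁻ x, ∑' k, ENNReal.ofReal (2 ^ k * b k x ^ 2) ∂unitMeasure ≠ ⊤ := by
      rw [lintegral_tsum fun k => (hi k).aemeasurable.ennreal_ofReal]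
      have : ∀ k, ∫⁻ x, ENNReal.ofReal (2 ^ k * b k x ^ 2) ∂unitMeasure
          = ENNReal.ofReal (2 ^ k * E k) := fun k => by
        rw [← ofReal_integral_eq_lintegral_ofReal (hi k) (ae_of_all _ fun x => by positivity),
          integral_const_mul, hEb]
      simp_rw [this]
      exact hEsum.tsum_ofReal_ne_top
    filter_upwards [ae_lt_top' (AEMeasurable.tsum fun k =>
      (hi k).aemeasurable.ennreal_ofReal) hlt] with x hx
    have hs : Summable fun k => 2 ^ k * b k x ^ 2 := by
      refine (ENNReal.summable_toReal hx.ne).congr fun k => ?_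
      exact ENNReal.toReal_ofReal (by positivity)
    refine Summable.of_norm_bounded (hs.add (summable_geometric_of_lt_one
      (r := 1 / 2) (by norm_num) (by norm_num))) fun k => ?_
    rw [Real.norm_eq_abs, ← sq_abs (b k x), one_div, inv_pow]
    have hr : (0 : ℝ) < 2 ^ k := by positivity
    generalize (2 : ℝ) ^ k = r at hr
    -- Completing the square gives `|b| ≤ r * b ^ 2 + r⁻¹` with `r = 2 ^ k`; both terms on the right
    -- are summable in `k`.
    have e : r * |b k x| ^ 2 + r⁻¹ - |b k x| =
        r * (|b k x| - r⁻¹ / 2) ^ 2 + 3 / 4 * r⁻¹ := by field_simp; ring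
    have : 0 ≤ r * (|b k x| - r⁻¹ / 2) ^ 2 + 3 / 4 * r⁻¹ := by positivity
    linarith
  -- Borel–Cantelli with `L = 2 ^ k`, along the countable family of thresholds `lam = 1 / (q + 1)`
  -- so that the null sets can be united.
  have hosc : ∀ q : ℕ, ∀ᵐ x ∂unitMeasure, ∀ᶠ k in atTop,
      x ∉ {x | ∃ m ∈ Finset.Icc (blockEnd k) (blockEnd (k + 1)),
        5 * (1 / ((q : ℝ) + 1)) ≤ |∑ j ∈ U k m, X j x|} := by
    intro q
    have hq : (0 : ℝ) < 1 / ((q : ℝ) + 1) := by positivity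
    refine ae_eventually_notMem (ne_top_of_le_ne_top ?_ (ENNReal.tsum_le_tsum fun k =>
      (hX.measure_max_ge_le h𝒜 hX2 (H := U k) (J := U k (blockEnd (k + 1)))
        (Finset.Icc (blockEnd k) (blockEnd (k + 1)))
        (fun m hm => Finset.biUnion_subset_biUnion_of_subset_left _
          (Finset.Ico_subset_Ico_right (Finset.mem_Icc.1 hm).2))
        (show (0 : ℝ) < 2 ^ k by positivity) hq).trans (ENNReal.ofReal_le_ofReal
          (add_le_add_right (card_block_mul_exp_le k) _))))
    refine Summable.tsum_ofReal_ne_top ?_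
    refine ((hEsum.mul_left (2 / (1 / ((q : ℝ) + 1)) ^ 2)).congr fun k => ?_).add
      ((summable_geometric_of_lt_one (r := (1 / 2 : ℝ)) (by norm_num) (by norm_num)).mul_left 4)
    simp only [hE]
    ring
  filter_upwards [hbsum, ae_all_iff.2 hosc] with x hx1 hx2
  refine tendsto_sum_range_of_blocks strictMono_blockEnd ?_ fun ε hε => ?_
  · simp_rw [hUsum]
    exact hx1
  · obtain ⟨q, hq⟩ := exists_nat_one_div_lt (show 0 < ε / 5 by positivity)
    filter_upwards [hx2 q] with k hk m hm
    rw [hUsum]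
    by_contra! h
    exact hk ⟨m, hm, le_trans (by linarith) h⟩

end IsMartingaleDifferenceOn

/-! ### Reduction to a single martingale difference. -/

theorem integral_sq_of_eLpNorm_eq_one {g : ℝ → ℝ} (hg : MemLp g 2 unitMeasure)
    (h : eLpNorm g 2 unitMeasure = 1) : ∫ x, g x ^ 2 ∂unitMeasure = 1 := by
  rw [hg.eLpNorm_eq_integral_rpow_norm (by norm_num) (by norm_num), ENNReal.ofReal_eq_one] at h
  simp only [ENNReal.toReal_ofNat, Real.rpow_ofNat, Real.norm_eq_abs, sq_abs] at h
  rwa [← one_div, ← Real.sqrt_eq_rpow, Real.sqrt_eq_one] at h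

/-- Coefficients `a n` spread over the disjoint index blocks `G n`. -/
theorem exists_forall_mem_eq {G : ℕ → Finset ℕ} (hG : ∀ m n, m ≠ n → Disjoint (G m) (G n))
    (a : ℕ → ℝ) :
    ∃ d : ℕ → ℝ, (∀ n, ∀ j ∈ G n, d j = a n) ∧ ∀ j, (∀ n, j ∉ G n) → d j = 0 := by
  classical
  refine ⟨fun j => if h : ∃ n, j ∈ G n then a h.choose else 0, fun n j hj => ?_, fun j hj => ?_⟩
  · have h : ∃ n, j ∈ G n := ⟨n, hj⟩
    simp only [dif_pos h]
    congr 1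
    by_contra hne
    exact Finset.disjoint_left.1 (hG _ _ hne) h.choose_spec hj
  · exact dif_neg fun ⟨n, hn⟩ => hj n hn

theorem corollary1 (f : ℕ → ℝ → ℝ) (hf : IsMartingaleDifference f)
    (G : ℕ → Finset ℕ) (hG : ∀ m n, m ≠ n → Disjoint (G m) (G n))
    (c : ℕ → ℝ) (p : ℕ → ℝ → ℝ)
    (hp : ∀ n x, p n x = ∑ j ∈ G n, c j * f j x)
    (hnorm : ∀ n, eLpNorm (p n) 2 unitMeasure = 1) :
    IsCMultiplier (fun n : ℕ => Real.logb 2 ((n : ℝ) + 1)) p := by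
  obtain ⟨𝒜, h𝒜, hf⟩ := hf
  have hcf := hf.const_mul c
  have hp' : ∀ n, p n = fun x => ∑ j ∈ G n, c j * f j x := fun n => funext (hp n)
  have hp2 : ∀ n, MemLp (p n) 2 unitMeasure := fun n => by
    refine ⟨?_, by simp [hnorm]⟩
    rw [hp']
    exact (integrable_finsetSum _ fun j _ => hcf.integrable j).aestronglyMeasurable
  have hsq : ∀ n, ∫ x, p n x ^ 2 ∂unitMeasure = 1 := fun n =>
    integral_sq_of_eLpNorm_eq_one (hp2 n) (hnorm n)
  have hcf2 : ∀ n, ∀ j ∈ G n, MemLp (fun x => c j * f j x) 2 unitMeasure := fun n j hj =>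
    hcf.memLp_two_of_sum h𝒜 (G n) (hp' n ▸ hp2 n) hj
  -- Disjointness of the blocks lets `a n` be absorbed into the differences. Indices outside every
  -- `G n` get coefficient `0`, since the `f j` there are only known to be integrable.
  have key : ∀ a : ℕ → ℝ, ∃ X : ℕ → ℝ → ℝ, IsMartingaleDifferenceOn 𝒜 X ∧
      (∀ j, MemLp (X j) 2 unitMeasure) ∧ ∀ n x, ∑ j ∈ G n, X j x = a n * p n x := by
    intro a
    obtain ⟨d, hd, hd0⟩ := exists_forall_mem_eq hG a
    refine ⟨_, hcf.const_mul d, fun j => ?_, fun n x => ?_⟩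
    · by_cases h : ∃ n, j ∈ G n
      · obtain ⟨n, hn⟩ := h
        exact (hcf2 n j hn).const_mul _
      · simp [hd0 j fun n hn => h ⟨n, hn⟩]
    · rw [hp, Finset.mul_sum]
      exact Finset.sum_congr rfl fun j hj => by rw [hd n j hj]
  refine ⟨⟨hp2, fun m n => ?_⟩, logb_add_one_nonneg, fun m n hmn => ?_, ?_, fun a ha => ?_⟩
  · split_ifs with h
    · subst h
      simpa only [sq] using hsq m
    -- Even with unit coefficients `key` is needed: it supplies a sequence lying entirely in `L²`.
    · obtain ⟨X, hX, hX2, hXp⟩ := key fun _ => 1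
      simpa only [hXp, one_mul] using hX.integral_sum_mul_sum_eq_zero h𝒜 hX2 (hG m n h)
  · exact Real.logb_le_logb_of_le (by norm_num) (by positivity) (by gcongr)
  · exact (Real.tendsto_logb_atTop (by norm_num)).comp
      (tendsto_atTop_add_const_right _ _ tendsto_natCast_atTop_atTop)
  · obtain ⟨X, hX, hX2, hXp⟩ := key a
    have := hX.ae_tendsto_sum h𝒜 hX2 hG
    simp only [hXp, mul_pow, integral_const_mul, hsq, mul_one] at this
    exact this ha
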